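/- Let $\mathcal{C}$ be a circle in the plane with center $O$, and let $\mathcal{E}_c$ be a (nondegenerate) ellipse contained in the open disk bounded by $\mathcal{C}$. Let $\mathcal{T}$ be the Poncelet family of all triangles inscribed in $\mathcal{C}$ whose three sidelines are tangent to $\mathcal{E}_c$, and suppose that $\mathcal{T}$ contains an equilateral triangle. The tangential triangle $T'$ of a triangle $T\in\mathcal{T}$ is the triangle whose sidelines are the tangents to $\mathcal{C}$ at the vertices of $T$. The Feuerbach point $X_{11}$ of a non-equilateral triangle is the point where its incircle touches its nine-point circle; the center $X_{110}$ of a non-equilateral triangle with sidelengths $a,b,c$ is the point with barycentric coordinates $\frac{a^2}{b^2-c^2}:\frac{b^2}{c^2-a^2}:\frac{c^2}{a^2-b^2}$ (after clearing denominators). Then: 1. The family of tangential triangles $T'$, $T\in\mathcal{T}$, contains an equilateral triangle. 2. If $O$ lies in the interior of $\mathcal{E}_c$, then every triangle of $\mathcal{T}$ is acute. 3. There is a point $K\in\mathcal{C}$ such that for every acute $T\in\mathcal{T}$ the tangential triangle $T'$ exists, its incircle is $\mathcal{C}$, and, unless $T'$ is equilateral, $X_{11}(T')=K=X_{110}(T)$.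 In particular, if $O$ lies in the interior of $\mathcal{E}_c$, then all tangential triangles circumscribe $\mathcal{C}$ and their Feuerbach point is stationary. -/

import Mathlib

open EuclideanGeometry

noncomputable section

/-- The ellipse with foci `f`, `g` and major axis of length `2 * a`
(nondegenerate exactly when `dist f g < 2 * a`; a circle when `f = g`). -/
def ellipse (f g : ℂ) (a : ℝ) : Set ℂ :=
  {z | dist z f + dist z g = 2 * a}

/-- The line carrying the side of the triangle `T` opposite to the vertex `i`. -/
def sideline (T : Affine.Triangle ℝ ℂ) (i : Fin 3) : AffineSubspace ℝ ℂ :=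
  affineSpan ℝ (Set.range (T.faceOpposite i).points)

/-- A line is tangent to a (nondegenerate) ellipse when they have exactly one common point. -/
def IsTangentToEllipse (l : AffineSubspace ℝ ℂ) (E : Set ℂ) : Prop :=
  ∃! z, z ∈ l ∧ z ∈ E

/-- The Poncelet family of triangles inscribed in the circle `S` and circumscribing
the ellipse `E`. -/
def ponceletFamily (S : Sphere ℂ) (E : Set ℂ) : Set (Affine.Triangle ℝ ℂ) :=
  {T | (∀ i, T.points i ∈ S) ∧ ∀ i, IsTangentToEllipse (sideline T i) E}

/-- `T'` is the tangential triangle of `T`: its sidelines are the tangents to the circumcircle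
of `T` at the vertices of `T`. -/
def IsTangentialTriangle (T T' : Affine.Triangle ℝ ℂ) : Prop :=
  ∀ i, T.circumsphere.IsTangentAt (T.points i) (sideline T' i)

/-- `P` is the Feuerbach point `X₁₁` of `T`: the incircle and the nine-point circle of `T` are
different circles (they coincide only for an equilateral triangle, which has no Feuerbach point)
and the former touches the latter internally at `P`. -/
def IsFeuerbachPoint (T : Affine.Triangle ℝ ℂ) (P : ℂ) : Prop :=
  T.insphere ≠ T.ninePointCircle ∧ T.insphere.IsIntTangentAt T.ninePointCircle P

/-- The triangle center `X₁₁₀`, with barycentric coordinates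
`a²/(b²-c²) : b²/(c²-a²) : c²/(a²-b²)`. The denominators are cleared, so that isosceles triangles
are covered; the sum of the weights vanishes only for equilateral triangles. -/
def x110 (T : Affine.Triangle ℝ ℂ) : ℂ :=
  let a := dist (T.points 1) (T.points 2)
  let b := dist (T.points 2) (T.points 0)
  let c := dist (T.points 0) (T.points 1)
  let u : ℝ := a ^ 2 * (c ^ 2 - a ^ 2) * (a ^ 2 - b ^ 2)
  let v : ℝ := b ^ 2 * (a ^ 2 - b ^ 2) * (b ^ 2 - c ^ 2)
  let w : ℝ := c ^ 2 * (b ^ 2 - c ^ 2) * (c ^ 2 - a ^ 2)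
  (u * T.points 0 + v * T.points 1 + w * T.points 2) / (u + v + w)

end

/-!
In the coordinate in which the circle is the unit circle, let `F`, `G` be the foci of the ellipse,
and let `h` be the sum and `p` the product of the vertices of a member of the family. Then `h` is
its orthocenter, and the triangle is acute if and only if `‖h‖ < 1`. Tangency of the sidelines makes
the vertices the roots of a cubic, whose quadratic term gives `h = F + G + p * conj (F * G)`. An
equilateral member has `h = 0`, so if `p₀` is the product of its vertices, then
`h = (p - p₀) * conj (F * G)`; hence `k = p * conj h / h` is the same point of the circle for all
members with `h ≠ 0`.

Both `X₁₁₀(T)` and the Feuerbach point of `T'` are `k`: the nine-point circle of `T'` is the image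
of the unit circle under the homothety with center `k` and ratio `1 / (1 - ‖h‖²)`.
-/

open scoped ComplexConjugate
open Filter

section Ellipse

theorem sideline_eq (T : Affine.Triangle ℝ ℂ) (i : Fin 3) :
    sideline T i = line[ℝ, T.points (i + 1), T.points (i + 2)] := by
  have compl_eq : ({i}ᶜ : Set (Fin 3)) = {i + 1, i + 2} := by
    ext j
    simp only [Set.mem_compl_iff, Set.mem_singleton_iff, Set.mem_insert_iff]
    decide +revert
  rw [sideline, Affine.Simplex.range_faceOpposite_points, compl_eq, Set.image_pair]

theorem le_of_existsUnique_eq {φ : ℝ → ℝ} {c : ℝ} (hφ : Continuous φ)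
    (hlim : Tendsto φ (cocompact ℝ) atTop) (h : ∃! t, φ t = c) (t : ℝ) : c ≤ φ t := by
  by_contra! hlt
  obtain ⟨s, hs, hsc⟩ := isPreconnected_Ici.intermediate_value_Ici Set.self_mem_Ici
    (le_principal_iff.2 (Ici_mem_atTop t)) hφ.continuousOn (hlim.mono_left atTop_le_cocompact)
    hlt.le
  obtain ⟨r, hr, hrc⟩ := isPreconnected_Iic.intermediate_value_Ici Set.self_mem_Iic
    (le_principal_iff.2 (Iic_mem_atBot t)) hφ.continuousOn (hlim.mono_left atBot_le_cocompact)
    hlt.le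
  have hst : s = t := le_antisymm ((h.unique hsc hrc).trans_le hr) hs
  exact hlt.ne (hst ▸ hsc)

theorem tendsto_norm_sub_add_norm_sub_cocompact (F G : ℂ) :
    Tendsto (fun t : ℝ ↦ ‖(t : ℂ) - F‖ + ‖(t : ℂ) - G‖) (cocompact ℝ) atTop := by
  refine tendsto_atTop_mono (fun t ↦ ?_)
    (tendsto_atTop_add_const_right _ (-‖F‖) (tendsto_norm_cocompact_atTop (E := ℝ)))
  have := norm_sub_norm_le (t : ℂ) F
  rw [Complex.norm_real] at this
  linarith [norm_nonneg ((t : ℂ) - G)]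

theorem exists_ofReal_norm_sub_add_norm_sub_eq {F G : ℂ} (h : F.im * G.im ≤ 0) :
    ∃ t : ℝ, ‖(t : ℂ) - F‖ + ‖(t : ℂ) - G‖ = ‖F - G‖ := by
  have h0 : (0 : ℝ) ∈ Complex.imLm.toAffineMap '' segment ℝ F G := by
    rw [image_segment, segment_eq_uIcc]
    exact Set.mem_uIcc.2 ((mul_nonpos_iff.1 h).symm.imp id And.symm)
  obtain ⟨z, hz, hz0⟩ := h0
  have hzre : (z.re : ℂ) = z := Complex.ext rfl hz0.symm
  have := dist_add_dist_of_mem_segment hz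
  rw [dist_eq_norm, dist_eq_norm, dist_eq_norm, norm_sub_rev F z] at this
  exact ⟨z.re, hzre ▸ this⟩

/- Reflecting one focus in the real axis when both lie on the same side of it, the minimum of the
sum of the distances becomes the distance between the foci. -/
theorem four_mul_im_mul_im_eq {F G : ℂ} {k : ℝ} (hk : ‖F - G‖ < k)
    (h : ∃! t : ℝ, ‖(t : ℂ) - F‖ + ‖(t : ℂ) - G‖ = k) :
    4 * (F.im * G.im) = k ^ 2 - ‖F - G‖ ^ 2 := by
  have k_le := le_of_existsUnique_eq (by fun_prop) (tendsto_norm_sub_add_norm_sub_cocompact F G) h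
  have norm_sub_conj (t : ℝ) : ‖(t : ℂ) - conj G‖ = ‖(t : ℂ) - G‖ := by
    rw [← Complex.norm_conj, map_sub, Complex.conj_conj, Complex.conj_ofReal]
  rcases le_or_gt (F.im * G.im) 0 with him | him
  · obtain ⟨t, ht⟩ := exists_ofReal_norm_sub_add_norm_sub_eq him
    linarith [k_le t]
  · obtain ⟨t, ht⟩ := exists_ofReal_norm_sub_add_norm_sub_eq (F := F) (G := conj G)
      (by rw [Complex.conj_im]; linarith)
    obtain ⟨t₀, ht₀, -⟩ := h
    have hk_eq : k = ‖F - conj G‖ := by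
      refine le_antisymm (ht ▸ norm_sub_conj t ▸ k_le t) ?_
      rw [← ht₀, ← norm_sub_conj, norm_sub_rev (t₀ : ℂ) F]
      exact norm_sub_le_norm_sub_add_norm_sub _ _ _
    rw [hk_eq, ← Complex.normSq_eq_norm_sq, ← Complex.normSq_eq_norm_sq, Complex.normSq_apply,
      Complex.normSq_apply]
    simp only [Complex.sub_re, Complex.sub_im, Complex.conj_re, Complex.conj_im]
    ring

theorem dist_lineMap_eq_norm_sub_mul {P Q : ℂ} (hPQ : P ≠ Q) (t : ℝ) (z : ℂ) :
    dist (AffineMap.lineMap P Q t) z = ‖(t : ℂ) - (z - P) / (Q - P)‖ * ‖Q - P‖ := by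
  have hd : Q - P ≠ 0 := sub_ne_zero.2 hPQ.symm
  rw [dist_eq_norm, ← norm_mul, sub_mul, div_mul_cancel₀ _ hd, AffineMap.lineMap_apply,
    vsub_eq_sub, vadd_eq_add, Complex.real_smul]
  congr 1
  ring

theorem IsTangentToEllipse.im_mul_im_eq {P Q f g : ℂ} {a : ℝ} (hPQ : P ≠ Q)
    (ha : dist f g < 2 * a) (h : IsTangentToEllipse line[ℝ, P, Q] (ellipse f g a)) :
    4 * (((f - P) / (Q - P)).im * ((g - P) / (Q - P)).im) * ‖Q - P‖ ^ 2 =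
      (2 * a) ^ 2 - dist f g ^ 2 := by
  have hd : 0 < ‖Q - P‖ := norm_pos_iff.2 (sub_ne_zero.2 hPQ.symm)
  have foci : ‖(f - P) / (Q - P) - (g - P) / (Q - P)‖ = dist f g / ‖Q - P‖ := by
    rw [← sub_div, norm_div, sub_sub_sub_cancel_right, dist_eq_norm]
  have mem_iff (t : ℝ) : AffineMap.lineMap P Q t ∈ ellipse f g a ↔
      ‖(t : ℂ) - (f - P) / (Q - P)‖ + ‖(t : ℂ) - (g - P) / (Q - P)‖ = 2 * a / ‖Q - P‖ := by
    rw [ellipse, Set.mem_ofPred_eq, dist_lineMap_eq_norm_sub_mul hPQ,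
      dist_lineMap_eq_norm_sub_mul hPQ, ← add_mul, eq_div_iff hd.ne']
  have unique_param : ∃! t : ℝ,
      ‖(t : ℂ) - (f - P) / (Q - P)‖ + ‖(t : ℂ) - (g - P) / (Q - P)‖ = 2 * a / ‖Q - P‖ := by
    obtain ⟨z, ⟨hz, hzE⟩, hz_unique⟩ := h
    obtain ⟨t, rfl⟩ := mem_affineSpan_pair_iff_exists_lineMap_eq.1 hz
    exact ⟨t, (mem_iff t).1 hzE, fun s hs ↦ AffineMap.lineMap_injective ℝ hPQ
      (hz_unique _ ⟨AffineMap.lineMap_mem_affineSpan_pair _ _ _, (mem_iff s).2 hs⟩)⟩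
  rw [four_mul_im_mul_im_eq (foci ▸ div_lt_div_of_pos_right ha hd) unique_param, foci]
  field_simp

end Ellipse

section Chord

theorem conj_coe_circle (x : Circle) : conj (x : ℂ) = (x : ℂ)⁻¹ := by
  rw [← Circle.coe_inv_eq_conj, Circle.coe_inv]

theorem ofReal_norm_sq (z : ℂ) : ((‖z‖ ^ 2 : ℝ) : ℂ) = z * conj z := by
  rw [Complex.mul_conj', Complex.ofReal_pow]

theorem ofReal_norm_sub_sq (x y : Circle) :
    ((‖(x - y : ℂ)‖ ^ 2 : ℝ) : ℂ) = -(x - y) ^ 2 / (x * y) := by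
  rw [ofReal_norm_sq, map_sub, conj_coe_circle, conj_coe_circle]
  field_simp [Circle.coe_ne_zero]
  ring

/-- The equation of the chord `xy` of the unit circle: it vanishes exactly on the line through
`x` and `y`. -/
def chordEquation (x y : Circle) (z : ℂ) : ℂ := z + x * y * conj z - x - y

theorem im_div_mul_two_I {x y : Circle} (hxy : x ≠ y) (z : ℂ) :
    (((z - x) / (y - x)).im : ℂ) * (2 * Complex.I) = chordEquation x y z / (y - x) := by
  have hyx : (y - x : ℂ) ≠ 0 := sub_ne_zero.2 (Circle.coe_injective.ne hxy.symm)
  have hxy' : (x - y : ℂ) ≠ 0 := sub_ne_zero.2 (Circle.coe_injective.ne hxy)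
  have h := Complex.sub_conj ((z - x) / (y - x))
  rw [map_div₀, map_sub, map_sub, conj_coe_circle, conj_coe_circle] at h
  push_cast at h
  rw [← mul_assoc, mul_comm _ (2 : ℂ), ← h, chordEquation]
  field_simp
  ring

theorem chordEquation_mul_chordEquation {x y : Circle} (hxy : x ≠ y) {F G : ℂ} {κ : ℝ}
    (h : 4 * (((F - x) / (y - x)).im * ((G - x) / (y - x)).im) * ‖(y - x : ℂ)‖ ^ 2 = κ) :
    chordEquation x y F * chordEquation x y G = κ * (x * y) := by
  have hyx : (y - x : ℂ) ≠ 0 := sub_ne_zero.2 (Circle.coe_injective.ne hxy.symm)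
  have hF := im_div_mul_two_I hxy F
  have hG := im_div_mul_two_I hxy G
  rw [eq_div_iff hyx] at hF hG
  rw [← h, Complex.ofReal_mul, ofReal_norm_sub_sq, ← hF, ← hG]
  push_cast
  field_simp
  linear_combination 4 * ((F - x) / (y - x) : ℂ).im * ((G - x) / (y - x) : ℂ).im *
    Complex.I_sq

end Chord

section Poncelet

theorem vieta_of_quadratic_roots {R : Type*} [CommRing R] [IsDomain R] {A B C y w : R}
    (hyw : y ≠ w) (hy : A * y ^ 2 + B * y + C = 0) (hw : A * w ^ 2 + B * w + C = 0) :
    A * (y + w) = -B ∧ A * (y * w) = C := by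
  constructor <;> refine mul_left_cancel₀ (sub_ne_zero.2 hyw) ?_
  · linear_combination hy - hw
  · linear_combination w * hy - y * hw

theorem sum_eq_of_cubic_roots {R : Type*} [CommRing R] [IsDomain R] {s b c x y w : R}
    (hxy : x ≠ y) (hwx : w ≠ x) (hyw : y ≠ w)
    (hx : x ^ 3 - s * x ^ 2 + b * x + c = 0) (hy : y ^ 3 - s * y ^ 2 + b * y + c = 0)
    (hw : w ^ 3 - s * w ^ 2 + b * w + c = 0) : x + y + w = s := by
  have hxy₂ : x ^ 2 + x * y + y ^ 2 - s * (x + y) + b = 0 := by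
    refine mul_left_cancel₀ (sub_ne_zero.2 hxy) ?_
    linear_combination hx - hy
  have hxw₂ : x ^ 2 + x * w + w ^ 2 - s * (x + w) + b = 0 := by
    refine mul_left_cancel₀ (sub_ne_zero.2 hwx.symm) ?_
    linear_combination hx - hw
  refine mul_left_cancel₀ (sub_ne_zero.2 hyw) ?_
  linear_combination hxy₂ - hxw₂

variable {x y w : Circle} {F G κ : ℂ}

/- For a fixed vertex `x`, tangency of `xy` and `xw` says that `y` and `w` are the roots of one
quadratic equation. -/
theorem vieta_of_chordEquation_mul (hyw : y ≠ w)
    (hxy : chordEquation x y F * chordEquation x y G = κ * (x * y))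
    (hwx : chordEquation w x F * chordEquation w x G = κ * (w * x)) :
    (x * conj F - 1) * (x * conj G - 1) * (y + w) =
        κ * x - (F - x) * (x * conj G - 1) - (G - x) * (x * conj F - 1) ∧
      (x * conj F - 1) * (x * conj G - 1) * (y * w) = (F - x) * (G - x) := by
  rw [chordEquation, chordEquation] at hxy hwx
  obtain ⟨hsum, hprod⟩ := vieta_of_quadratic_roots (Circle.coe_injective.ne hyw)
    (A := (x * conj F - 1) * (x * conj G - 1)) (C := (F - x) * (G - x))
    (B := (F - x) * (x * conj G - 1) + (G - x) * (x * conj F - 1) - κ * x)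
    (by linear_combination hxy) (by linear_combination hwx)
  exact ⟨by linear_combination hsum, hprod⟩

theorem sum_eq_of_chordEquation_mul (hxy_ne : x ≠ y) (hyw_ne : y ≠ w) (hwx_ne : w ≠ x)
    (hxy : chordEquation x y F * chordEquation x y G = κ * (x * y))
    (hyw : chordEquation y w F * chordEquation y w G = κ * (y * w))
    (hwx : chordEquation w x F * chordEquation w x G = κ * (w * x)) :
    (x + y + w : ℂ) = F + G + x * y * w * (conj F * conj G) := by
  have hx := (vieta_of_chordEquation_mul hyw_ne hxy hwx).2
  have hy := (vieta_of_chordEquation_mul hwx_ne hyw hxy).2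
  have hw := (vieta_of_chordEquation_mul hxy_ne hwx hyw).2
  refine sum_eq_of_cubic_roots (b := F * G + x * y * w * (conj F + conj G))
    (c := -(x * y * w)) (Circle.coe_injective.ne hxy_ne) (Circle.coe_injective.ne hwx_ne)
    (Circle.coe_injective.ne hyw_ne) ?_ ?_ ?_
  · linear_combination (-(x : ℂ)) * hx
  · linear_combination (-(y : ℂ)) * hy
  · linear_combination (-(w : ℂ)) * hw

/- For `F = G` this is the Chapple–Euler relation between a circle and an inscribed circle. -/
theorem eq_one_sub_mul_of_chordEquation_mul (hxy_ne : x ≠ y) (hyw_ne : y ≠ w) (hwx_ne : w ≠ x)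
    (hxy : chordEquation x y F * chordEquation x y G = κ * (x * y))
    (hyw : chordEquation y w F * chordEquation y w G = κ * (y * w))
    (hwx : chordEquation w x F * chordEquation w x G = κ * (w * x)) :
    κ = (1 - F * conj F) * (1 - G * conj G) := by
  have hsum := sum_eq_of_chordEquation_mul hxy_ne hyw_ne hwx_ne hxy hyw hwx
  obtain ⟨hx_sum, hx_prod⟩ := vieta_of_chordEquation_mul hyw_ne hxy hwx
  refine mul_right_cancel₀ x.coe_ne_zero ?_
  linear_combination -hx_sum + (x * conj F - 1) * (x * conj G - 1) * hsum +
    x * conj F * conj G * hx_prod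

end Poncelet

section UnitCircle

variable (x y w : Circle)

theorem ofReal_inner (u v : ℂ) : ((inner ℝ u v : ℝ) : ℂ) = (u * conj v + conj u * v) / 2 := by
  rw [Complex.inner, Complex.re_eq_add_conj, map_mul, Complex.conj_conj, add_comm (u * _)]
  ring

theorem ofReal_inner_sub_sub : ((inner ℝ (y - x : ℂ) (w - x) : ℝ) : ℂ) =
    -((y - x) * (w - x) * (y + w)) / (2 * (x * y * w)) := by
  simp only [ofReal_inner, map_sub, conj_coe_circle]
  field_simp
  ring

theorem mul_conj_sum : (x * y * w : ℂ) * conj (x + y + w : ℂ) = x * y + y * w + w * x := by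
  simp only [map_add, conj_coe_circle]
  field_simp
  ring

theorem ofReal_norm_sum_sq : ((‖(x + y + w : ℂ)‖ ^ 2 : ℝ) : ℂ) =
    (x + y + w) * (x * y + y * w + w * x) / (x * y * w) := by
  rw [ofReal_norm_sq, ← mul_conj_sum]
  field_simp

theorem mul_add_eq_neg_mul_one_sub_norm_sq : (x + y : ℂ) * (y + w) * (w + x) =
    -(x * y * w) * ((1 - ‖(x + y + w : ℂ)‖ ^ 2 : ℝ) : ℂ) := by
  rw [Complex.ofReal_sub, Complex.ofReal_one, ofReal_norm_sum_sq]
  field_simp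
  ring

theorem eight_mul_inner_mul_inner_mul_inner :
    8 * (inner ℝ (y - x : ℂ) (w - x) * inner ℝ (w - y : ℂ) (x - y) * inner ℝ (x - w : ℂ) (y - w)) =
      ‖(x - y : ℂ)‖ ^ 2 * ‖(y - w : ℂ)‖ ^ 2 * ‖(w - x : ℂ)‖ ^ 2 *
        (1 - ‖(x + y + w : ℂ)‖ ^ 2) := by
  apply Complex.ofReal_injective
  simp only [Complex.ofReal_mul, Complex.ofReal_sub, Complex.ofReal_one, ofReal_inner_sub_sub,
    ofReal_norm_sub_sq, ofReal_norm_sum_sq]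
  push_cast
  field_simp
  ring

variable {x y w}

theorem norm_sum_lt_one_of_inner_pos (hx : 0 < inner ℝ (y - x : ℂ) (w - x))
    (hy : 0 < inner ℝ (w - y : ℂ) (x - y)) (hw : 0 < inner ℝ (x - w : ℂ) (y - w)) :
    ‖(x + y + w : ℂ)‖ < 1 := by
  have hpos := mul_pos (by norm_num : (0 : ℝ) < 8) (mul_pos (mul_pos hx hy) hw)
  rw [eight_mul_inner_mul_inner_mul_inner] at hpos
  have := pos_of_mul_pos_right hpos (by positivity)
  exact (sq_lt_one_iff₀ (norm_nonneg _)).1 (sub_pos.1 this)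

/- The product of the three inner products is positive, and the sum of any two of them is the
square of a side, so none can be nonpositive. -/
theorem inner_pos_of_norm_sum_lt_one (hxy : x ≠ y) (hyw : y ≠ w) (hwx : w ≠ x)
    (h : ‖(x + y + w : ℂ)‖ < 1) : 0 < inner ℝ (y - x : ℂ) (w - x) := by
  have sq_pos {p q : Circle} (hpq : p ≠ q) : 0 < ‖(p - q : ℂ)‖ ^ 2 :=
    pow_pos (norm_pos_iff.2 (sub_ne_zero.2 (Circle.coe_injective.ne hpq))) 2
  have inner_add_inner (p q r : ℂ) :
      inner ℝ (q - p) (r - p) + inner ℝ (r - q) (p - q) = ‖p - q‖ ^ 2 := by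
    rw [real_inner_comm, ← neg_sub q p, inner_neg_right, ← sub_eq_add_neg, ← inner_sub_left,
      sub_sub_sub_cancel_left, real_inner_self_eq_norm_sq, norm_neg]
  have hprod := eight_mul_inner_mul_inner_mul_inner x y w
  have hpos : 0 < 1 - ‖(x + y + w : ℂ)‖ ^ 2 :=
    sub_pos.2 ((sq_lt_one_iff₀ (norm_nonneg _)).2 h)
  have hprod_pos := mul_pos (mul_pos (mul_pos (sq_pos hxy) (sq_pos hyw)) (sq_pos hwx)) hpos
  rw [← hprod] at hprod_pos
  by_contra! hneg
  have hy : 0 < inner ℝ (w - y : ℂ) (x - y) := by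
    linarith [inner_add_inner x y w, sq_pos hxy]
  have hw : 0 < inner ℝ (x - w : ℂ) (y - w) := by
    linarith [inner_add_inner w x y, sq_pos hwx]
  linarith [mul_nonpos_of_nonpos_of_nonneg
    (mul_nonpos_of_nonpos_of_nonneg hneg hy.le) hw.le]

theorem add_ne_zero_of_norm_sum_lt_one (h : ‖(x + y + w : ℂ)‖ < 1) : (y + w : ℂ) ≠ 0 := by
  intro h0
  rw [add_assoc, h0, add_zero, Circle.norm_coe] at h
  exact h.false

end UnitCircle

section ChordPole

variable {x y w : Circle}

/-- The pole of the chord `xy` of the unit circle, that is, the intersection of the tangents at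
`x` and `y`. It is the junk value `0` if `y = -x`, when these tangents are parallel. -/
noncomputable def chordPole (x y : Circle) : ℂ := 2 * (x * y) / (x + y)

theorem chordPole_comm (x y : Circle) : chordPole x y = chordPole y x := by
  rw [chordPole, chordPole, mul_comm (x : ℂ), add_comm (x : ℂ)]

theorem eq_chordPole {v : ℂ} (hxy : x ≠ y) (hadd : (x + y : ℂ) ≠ 0) (hx : inner ℝ (x : ℂ) v = 1)
    (hy : inner ℝ (y : ℂ) v = 1) : v = chordPole x y := by
  have tangent_eq {p : Circle} (h : inner ℝ (p : ℂ) v = 1) : p ^ 2 * conj v + v = 2 * p := by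
    have h' := ofReal_inner p v
    rw [h, conj_coe_circle] at h'
    field_simp at h'
    push_cast at h'
    linear_combination -h'
  rw [chordPole, eq_div_iff hadd]
  refine mul_left_cancel₀ (sub_ne_zero.2 (Circle.coe_injective.ne hxy.symm)) ?_
  linear_combination y ^ 2 * tangent_eq hx - x ^ 2 * tangent_eq hy

theorem conj_chordPole (hadd : (x + y : ℂ) ≠ 0) : conj (chordPole x y) = 2 / (x + y) := by
  have hadd' : (y + x : ℂ) ≠ 0 := by rwa [add_comm]
  simp only [chordPole, map_div₀, map_mul, map_add, conj_coe_circle, map_ofNat]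
  field_simp
  ring

theorem inner_chordPole_left (hadd : (x + y : ℂ) ≠ 0) : inner ℝ (x : ℂ) (chordPole x y) = 1 := by
  apply Complex.ofReal_injective
  rw [ofReal_inner, conj_chordPole hadd, conj_coe_circle, chordPole]
  push_cast
  field_simp

theorem inner_chordPole_right (hadd : (x + y : ℂ) ≠ 0) : inner ℝ (y : ℂ) (chordPole x y) = 1 := by
  rw [chordPole_comm]
  exact inner_chordPole_left (by rwa [add_comm])

theorem one_sub_inner_chordPole_mul (hadd : (y + w : ℂ) ≠ 0) :
    (1 - inner ℝ (x : ℂ) (chordPole y w)) * ‖(y + w : ℂ)‖ ^ 2 =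
      2 * inner ℝ (y - x : ℂ) (w - x) := by
  apply Complex.ofReal_injective
  rw [Complex.ofReal_mul, Complex.ofReal_mul, Complex.ofReal_sub, ofReal_norm_sq,
    ofReal_inner_sub_sub, ofReal_inner, conj_chordPole hadd, chordPole]
  simp only [conj_coe_circle, map_add]
  push_cast
  field_simp
  ring

theorem inner_chordPole_lt_one (hxy : x ≠ y) (hyw : y ≠ w) (hwx : w ≠ x)
    (h : ‖(x + y + w : ℂ)‖ < 1) : inner ℝ (x : ℂ) (chordPole y w) < 1 := by
  have hadd := add_ne_zero_of_norm_sum_lt_one h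
  have hpos : 0 < (1 - inner ℝ (x : ℂ) (chordPole y w)) * ‖(y + w : ℂ)‖ ^ 2 := by
    rw [one_sub_inner_chordPole_mul hadd]
    linarith [inner_pos_of_norm_sum_lt_one hxy hyw hwx h]
  exact sub_pos.1 (pos_of_mul_pos_left hpos (by positivity))

/- The circumcenter of the tangential triangle is `-2h / (1 - ‖h‖²)`, where `h = x + y + w`. -/
theorem chordPole_add_eq (h : ‖(x + y + w : ℂ)‖ < 1) :
    chordPole y w + (2 / (1 - ‖(x + y + w : ℂ)‖ ^ 2) : ℝ) * (x + y + w) =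
      -(2 / (1 - ‖(x + y + w : ℂ)‖ ^ 2) : ℝ) * (y * w / x : Circle) := by
  have hadd := add_ne_zero_of_norm_sum_lt_one h
  have hprod := mul_add_eq_neg_mul_one_sub_norm_sq x y w
  have hne : ((1 - ‖(x + y + w : ℂ)‖ ^ 2 : ℝ) : ℂ) ≠ 0 := by
    exact_mod_cast (sub_pos.2 ((sq_lt_one_iff₀ (norm_nonneg _)).2 h)).ne'
  rw [chordPole, Complex.ofReal_div, Circle.coe_div, Circle.coe_mul]
  generalize ((1 - ‖(x + y + w : ℂ)‖ ^ 2 : ℝ) : ℂ) = d at *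
  push_cast
  field_simp
  linear_combination hprod

theorem chordPole_add_chordPole_add_chordPole (h : ‖(x + y + w : ℂ)‖ < 1) :
    chordPole y w + chordPole w x + chordPole x y +
        (2 / (1 - ‖(x + y + w : ℂ)‖ ^ 2) : ℝ) * (x + y + w) =
      -(2 / (1 - ‖(x + y + w : ℂ)‖ ^ 2) : ℝ) * (x * y * w * conj (x + y + w : ℂ) ^ 2) := by
  have hyw := add_ne_zero_of_norm_sum_lt_one h
  have hwx : (w + x : ℂ) ≠ 0 := add_ne_zero_of_norm_sum_lt_one (x := y) (by rwa [← add_rotate])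
  have hxy : (x + y : ℂ) ≠ 0 := add_ne_zero_of_norm_sum_lt_one (x := w) (by rwa [add_rotate])
  have hd : ((1 - ‖(x + y + w : ℂ)‖ ^ 2 : ℝ) : ℂ) =
      -((x + y) * (y + w) * (w + x)) / (x * y * w) := by
    rw [mul_add_eq_neg_mul_one_sub_norm_sq]
    field_simp
  rw [Complex.ofReal_div, hd]
  simp only [chordPole, map_add, conj_coe_circle]
  push_cast
  field_simp
  ring

theorem chordPole_eq_of_sum_eq_zero (h : (x + y + w : ℂ) = 0) : chordPole y w = -2 * x := by
  have hadd : (y + w : ℂ) = -x := by linear_combination h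
  have hconj := mul_conj_sum x y w
  rw [h, map_zero, mul_zero] at hconj
  rw [chordPole, hadd]
  field_simp
  linear_combination hconj + x * hadd

theorem norm_sub_sq_of_sum_eq_zero (h : (x + y + w : ℂ) = 0) : ‖(x - y : ℂ)‖ ^ 2 = 3 := by
  have hadd : (x + y : ℂ) = -w := by linear_combination h
  have hpar := parallelogram_law_with_norm ℝ (x : ℂ) y
  rw [hadd, norm_neg, Circle.norm_coe, Circle.norm_coe, Circle.norm_coe] at hpar
  linarith

end ChordPole

section UnitCoord

/-- The complex coordinate in which the circle `S` is the unit circle. -/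
noncomputable def unitCoord (S : Sphere ℂ) (p : ℂ) : ℂ := (p - S.center) / S.radius

variable {S : Sphere ℂ}

theorem unitCoord_center_add (hS : 0 < S.radius) (v : ℂ) :
    unitCoord S (S.center + S.radius * v) = v := by
  have : (S.radius : ℂ) ≠ 0 := by exact_mod_cast hS.ne'
  rw [unitCoord, add_sub_cancel_left, mul_div_cancel_left₀ _ this]

theorem center_add_mul_unitCoord (hS : 0 < S.radius) (p : ℂ) :
    S.center + S.radius * unitCoord S p = p := by
  have : (S.radius : ℂ) ≠ 0 := by exact_mod_cast hS.ne'
  rw [unitCoord, mul_div_cancel₀ _ this, add_sub_cancel]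

theorem norm_unitCoord_sub_unitCoord (hS : 0 < S.radius) (p q : ℂ) :
    ‖unitCoord S p - unitCoord S q‖ = dist p q / S.radius := by
  rw [unitCoord, unitCoord, ← sub_div, norm_div, sub_sub_sub_cancel_right, Complex.norm_real,
    Real.norm_of_nonneg hS.le, dist_eq_norm]

theorem norm_unitCoord (hS : 0 < S.radius) (p : ℂ) :
    ‖unitCoord S p‖ = dist p S.center / S.radius := by
  rw [unitCoord, norm_div, Complex.norm_real, Real.norm_of_nonneg hS.le, dist_eq_norm]

theorem center_add_mul_circle_mem (hS : 0 ≤ S.radius) (k : Circle) :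
    S.center + S.radius * k ∈ S := by
  rw [mem_sphere, dist_self_add_left, norm_mul, Circle.norm_coe, mul_one, Complex.norm_real,
    Real.norm_of_nonneg hS]

theorem inner_sub_sub_eq (hS : 0 < S.radius) (p q r s : ℂ) :
    inner ℝ (p - q) (r - s) = S.radius ^ 2 *
      inner ℝ (unitCoord S p - unitCoord S q) (unitCoord S r - unitCoord S s) := by
  have sub_eq (p q : ℂ) : p - q = S.radius • (unitCoord S p - unitCoord S q) := by
    rw [Complex.real_smul]
    linear_combination center_add_mul_unitCoord hS q - center_add_mul_unitCoord hS p
  rw [sub_eq p q, sub_eq r s, real_inner_smul_left, real_inner_smul_right]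
  ring

end UnitCoord

section UnitVertex

theorem circumsphere_radius_pos (T : Affine.Triangle ℝ ℂ) : 0 < T.circumsphere.radius :=
  T.circumradius_pos

/-- The vertices of `T` in the coordinate in which its circumcircle is the unit circle. -/
noncomputable def unitVertex (T : Affine.Triangle ℝ ℂ) (i : Fin 3) : Circle :=
  ⟨unitCoord T.circumsphere (T.points i), mem_sphere_zero_iff_norm.2 <| by
    rw [norm_unitCoord (circumsphere_radius_pos T), mem_sphere.1 (T.mem_circumsphere i),
      div_self (circumsphere_radius_pos T).ne']⟩

/-- The orthocenter of `T` in the coordinate in which its circumcircle is the unit circle. -/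
noncomputable def unitOrthocenter (T : Affine.Triangle ℝ ℂ) : ℂ := ∑ i, (unitVertex T i : ℂ)

variable (T : Affine.Triangle ℝ ℂ)

theorem coe_unitVertex (i : Fin 3) :
    (unitVertex T i : ℂ) = unitCoord T.circumsphere (T.points i) := rfl

theorem unitVertex_injective : Function.Injective (unitVertex T) := by
  intro i j h
  refine T.independent.injective ?_
  rw [← center_add_mul_unitCoord (circumsphere_radius_pos T) (T.points i), ← coe_unitVertex, h,
    coe_unitVertex, center_add_mul_unitCoord (circumsphere_radius_pos T)]

theorem unitVertex_add_unitVertex_add_unitVertex (i : Fin 3) :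
    (unitVertex T i + unitVertex T (i + 1) + unitVertex T (i + 2) : ℂ) = unitOrthocenter T := by
  rw [unitOrthocenter, Fin.sum_univ_three]
  fin_cases i <;> simp only [Fin.reduceFinMk, Fin.isValue, Fin.reduceAdd] <;> ring

theorem coe_prod_unitVertex (i : Fin 3) : ((∏ j, unitVertex T j : Circle) : ℂ) =
    unitVertex T i * unitVertex T (i + 1) * unitVertex T (i + 2) := by
  rw [Fin.prod_univ_three, Circle.coe_mul, Circle.coe_mul]
  fin_cases i <;> simp only [Fin.reduceFinMk, Fin.isValue, Fin.reduceAdd] <;> ring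

theorem angle_lt_pi_div_two_iff_inner_pos {p q r : ℂ} (hp : p ≠ q) (hr : r ≠ q) :
    ∠ p q r < Real.pi / 2 ↔ 0 < inner ℝ (p - q) (r - q) := by
  have hpos : 0 < ‖p - q‖ * ‖r - q‖ :=
    mul_pos (norm_pos_iff.2 (sub_ne_zero.2 hp)) (norm_pos_iff.2 (sub_ne_zero.2 hr))
  rw [EuclideanGeometry.angle, InnerProductGeometry.angle, Real.arccos_lt_pi_div_two, vsub_eq_sub,
    vsub_eq_sub]
  exact div_pos_iff_of_pos_right hpos

theorem angle_lt_pi_div_two_iff_inner_unitVertex_pos {i j k : Fin 3} (hij : i ≠ j) (hkj : k ≠ j) :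
    ∠ (T.points i) (T.points j) (T.points k) < Real.pi / 2 ↔
      0 < inner ℝ (unitVertex T i - unitVertex T j : ℂ) (unitVertex T k - unitVertex T j) := by
  have hR := circumsphere_radius_pos T
  rw [angle_lt_pi_div_two_iff_inner_pos (T.independent.injective.ne hij)
    (T.independent.injective.ne hkj), inner_sub_sub_eq hR]
  exact mul_pos_iff_of_pos_left (pow_pos hR 2)

theorem acuteAngled_iff_norm_unitOrthocenter_lt_one :
    T.AcuteAngled ↔ ‖unitOrthocenter T‖ < 1 := by
  have z_ne {i j : Fin 3} (h : i ≠ j) : unitVertex T i ≠ unitVertex T j :=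
    (unitVertex_injective T).ne h
  have sum_eq := unitVertex_add_unitVertex_add_unitVertex T
  rw [Affine.Triangle.acuteAngled_iff_angle_lt, angle_comm _ (T.points 1),
    angle_comm _ (T.points 2), angle_comm _ (T.points 0)]
  repeat rw [angle_lt_pi_div_two_iff_inner_unitVertex_pos T (by decide) (by decide)]
  refine ⟨fun ⟨h₁, h₂, h₀⟩ ↦ sum_eq 0 ▸ norm_sum_lt_one_of_inner_pos h₀ h₁ h₂, fun h ↦ ⟨?_, ?_, ?_⟩⟩
  · exact inner_pos_of_norm_sum_lt_one (z_ne (by decide)) (z_ne (by decide)) (z_ne (by decide))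
      ((sum_eq 1).symm ▸ h)
  · exact inner_pos_of_norm_sum_lt_one (z_ne (by decide)) (z_ne (by decide)) (z_ne (by decide))
      ((sum_eq 2).symm ▸ h)
  · exact inner_pos_of_norm_sum_lt_one (z_ne (by decide)) (z_ne (by decide)) (z_ne (by decide))
      ((sum_eq 0).symm ▸ h)

end UnitVertex

section X110

/-- The unnormalised barycentric coordinate of `X₁₁₀` at the vertex opposite to the side with
squared length `A`, where `B` and `C` are the squared lengths of the other two sides, in cyclic
order. -/
def x110Weight (A B C : ℝ) : ℝ := A * (C - A) * (A - B)

theorem x110Weight_mul (r A B C : ℝ) :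
    x110Weight (r * A) (r * B) (r * C) = r ^ 3 * x110Weight A B C := by
  rw [x110Weight, x110Weight]
  ring

theorem x110Weight_add_add (x y w : Circle) {A B C : ℝ} (hA : A = ‖(y - w : ℂ)‖ ^ 2)
    (hB : B = ‖(w - x : ℂ)‖ ^ 2) (hC : C = ‖(x - y : ℂ)‖ ^ 2) :
    x110Weight A B C + x110Weight B C A + x110Weight C A B =
      -(A * B * C * ‖(x + y + w : ℂ)‖ ^ 2) := by
  apply Complex.ofReal_injective
  subst hA hB hC
  simp only [x110Weight, Complex.ofReal_mul, Complex.ofReal_sub, Complex.ofReal_add,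
    Complex.ofReal_neg, ofReal_norm_sub_sq, ofReal_norm_sum_sq]
  field_simp
  ring

theorem sum_mul_x110Weight_mul_add_add (x y w : Circle) {A B C : ℝ} (hA : A = ‖(y - w : ℂ)‖ ^ 2)
    (hB : B = ‖(w - x : ℂ)‖ ^ 2) (hC : C = ‖(x - y : ℂ)‖ ^ 2) :
    (x + y + w : ℂ) * (x110Weight A B C * x + x110Weight B C A * y + x110Weight C A B * w) =
      x * y * w * conj (x + y + w : ℂ) *
        (x110Weight A B C + x110Weight B C A + x110Weight C A B : ℝ) := by
  subst hA hB hC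
  rw [mul_conj_sum]
  simp only [x110Weight, Complex.ofReal_mul, Complex.ofReal_sub, Complex.ofReal_add,
    ofReal_norm_sub_sq]
  field_simp
  ring

variable {T : Affine.Triangle ℝ ℂ}

theorem dist_points_sq (T : Affine.Triangle ℝ ℂ) (i j : Fin 3) :
    dist (T.points i) (T.points j) ^ 2 =
      T.circumsphere.radius ^ 2 * ‖(unitVertex T i - unitVertex T j : ℂ)‖ ^ 2 := by
  have hR := circumsphere_radius_pos T
  rw [coe_unitVertex, coe_unitVertex, norm_unitCoord_sub_unitCoord hR]
  field_simp

theorem x110_eq_center_add (T : Affine.Triangle ℝ ℂ) {A B C : ℝ}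
    (hA : A = ‖(unitVertex T 1 - unitVertex T 2 : ℂ)‖ ^ 2)
    (hB : B = ‖(unitVertex T 2 - unitVertex T 0 : ℂ)‖ ^ 2)
    (hC : C = ‖(unitVertex T 0 - unitVertex T 1 : ℂ)‖ ^ 2)
    (hsum : x110Weight A B C + x110Weight B C A + x110Weight C A B ≠ 0) :
    x110 T = T.circumsphere.center + T.circumsphere.radius *
      ((x110Weight A B C * unitVertex T 0 + x110Weight B C A * unitVertex T 1 +
        x110Weight C A B * unitVertex T 2) /
      (x110Weight A B C + x110Weight B C A + x110Weight C A B : ℝ)) := by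
  have hR := circumsphere_radius_pos T
  have hR' : (T.circumsphere.radius : ℂ) ≠ 0 := by exact_mod_cast hR.ne'
  have points_eq (i : Fin 3) :
      T.points i = T.circumsphere.center + T.circumsphere.radius * unitVertex T i :=
    (center_add_mul_unitCoord hR _).symm
  have hsum' : (x110Weight A B C + x110Weight B C A + x110Weight C A B : ℂ) ≠ 0 := by
    exact_mod_cast hsum
  have x110_eq_div (a b c : ℝ) (ha : a = dist (T.points 1) (T.points 2) ^ 2)
      (hb : b = dist (T.points 2) (T.points 0) ^ 2)
      (hc : c = dist (T.points 0) (T.points 1) ^ 2) :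
      x110 T = (x110Weight a b c * T.points 0 + x110Weight b c a * T.points 1 +
        x110Weight c a b * T.points 2) /
          (x110Weight a b c + x110Weight b c a + x110Weight c a b) := by
    subst ha hb hc
    rfl
  rw [x110_eq_div _ _ _ (dist_points_sq T 1 2).symm (dist_points_sq T 2 0).symm
    (dist_points_sq T 0 1).symm, ← hA, ← hB, ← hC]
  simp only [x110Weight_mul, points_eq]
  push_cast
  field_simp
  ring

theorem norm_unitVertex_sub_pos (T : Affine.Triangle ℝ ℂ) {i j : Fin 3} (h : i ≠ j) :
    0 < ‖(unitVertex T i - unitVertex T j : ℂ)‖ :=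
  norm_pos_iff.2 (sub_ne_zero.2 (Circle.coe_injective.ne ((unitVertex_injective T).ne h)))

theorem x110_eq_of_mul_unitOrthocenter_eq {k : ℂ} (h0 : unitOrthocenter T ≠ 0)
    (hk : k * unitOrthocenter T = (∏ i, unitVertex T i : Circle) * conj (unitOrthocenter T)) :
    x110 T = T.circumsphere.center + T.circumsphere.radius * k := by
  rw [← unitVertex_add_unitVertex_add_unitVertex T 0] at h0 hk
  rw [coe_prod_unitVertex T 0] at hk
  simp only [zero_add] at h0 hk
  obtain ⟨A, hA⟩ : ∃ A, A = ‖(unitVertex T 1 - unitVertex T 2 : ℂ)‖ ^ 2 := ⟨_, rfl⟩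
  obtain ⟨B, hB⟩ : ∃ B, B = ‖(unitVertex T 2 - unitVertex T 0 : ℂ)‖ ^ 2 := ⟨_, rfl⟩
  obtain ⟨C, hC⟩ : ∃ C, C = ‖(unitVertex T 0 - unitVertex T 1 : ℂ)‖ ^ 2 := ⟨_, rfl⟩
  have weight_sum_ne : x110Weight A B C + x110Weight B C A + x110Weight C A B ≠ 0 := by
    rw [x110Weight_add_add _ _ _ hA hB hC, hA, hB, hC]
    have := norm_unitVertex_sub_pos T (i := 1) (j := 2) (by decide)
    have := norm_unitVertex_sub_pos T (i := 2) (j := 0) (by decide)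
    have := norm_unitVertex_sub_pos T (i := 0) (j := 1) (by decide)
    have := norm_pos_iff.2 h0
    exact neg_ne_zero.2 (by positivity)
  have weighted_sum := sum_mul_x110Weight_mul_add_add _ _ _ hA hB hC
  rw [← hk, mul_right_comm, mul_comm (_ + _ + _ : ℂ)] at weighted_sum
  replace weighted_sum := mul_right_cancel₀ h0 weighted_sum
  rw [x110_eq_center_add T hA hB hC weight_sum_ne, weighted_sum,
    mul_div_cancel_right₀ _ (by exact_mod_cast weight_sum_ne)]

/- The weights of `X₁₁₀` vanish when the sides are equal, while their sum is a nonzero multiple of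
`‖unitOrthocenter T‖ ^ 2`. -/
theorem unitOrthocenter_eq_zero_of_equilateral (hT : T.Equilateral) : unitOrthocenter T = 0 := by
  have side_eq {i j k l : Fin 3} (hij : i ≠ j) (hkl : k ≠ l) :
      ‖(unitVertex T i - unitVertex T j : ℂ)‖ ^ 2 =
        ‖(unitVertex T k - unitVertex T l : ℂ)‖ ^ 2 := by
    have hR := circumsphere_radius_pos T
    have h := congrArg (· ^ 2) (hT.dist_eq hij hkl)
    simp only [dist_points_sq] at h
    exact mul_left_cancel₀ (pow_pos hR 2).ne' h
  have h := x110Weight_add_add (unitVertex T 0) (unitVertex T 1) (unitVertex T 2) rfl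
    (side_eq (k := 2) (l := 0) (i := 1) (j := 2) (by decide) (by decide))
    (side_eq (k := 0) (l := 1) (i := 1) (j := 2) (by decide) (by decide))
  have hside := pow_pos (norm_unitVertex_sub_pos T (i := 1) (j := 2) (by decide)) 2
  simp only [x110Weight, sub_self, mul_zero, add_zero, zero_eq_neg, mul_eq_zero, hside.ne',
    false_or] at h
  rw [← unitVertex_add_unitVertex_add_unitVertex T 0]
  exact norm_eq_zero.1 (pow_eq_zero_iff two_ne_zero |>.1 h)

end X110

section PonceletFamily

variable {S : Sphere ℂ} {f g : ℂ} {a : ℝ} {T T₀ : Affine.Triangle ℝ ℂ}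

theorem affineSpan_range_points_eq_top (T : Affine.Triangle ℝ ℂ) :
    affineSpan ℝ (Set.range T.points) = ⊤ := by
  rw [T.independent.affineSpan_eq_top_iff_card_eq_finrank_add_one]
  simp

theorem circumsphere_eq_of_mem_ponceletFamily {E : Set ℂ} (hT : T ∈ ponceletFamily S E) :
    T.circumsphere = S := by
  refine (T.circumsphere_unique_dist_eq.2 S ⟨?_, Set.range_subset_iff.2 hT.1⟩).symm
  rw [affineSpan_range_points_eq_top]
  exact AffineSubspace.mem_top _ _ _

theorem unitCoord_sub_div_unitCoord_sub (hS : 0 < S.radius) (p q r s : ℂ) :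
    (unitCoord S p - unitCoord S q) / (unitCoord S r - unitCoord S s) = (p - q) / (r - s) := by
  have : (S.radius : ℂ) ≠ 0 := by exact_mod_cast hS.ne'
  rw [unitCoord, unitCoord, unitCoord, unitCoord, ← sub_div, ← sub_div,
    div_div_div_cancel_right₀ this, sub_sub_sub_cancel_right, sub_sub_sub_cancel_right]

theorem chordEquation_unitVertex_mul (ha : dist f g < 2 * a)
    (hT : T ∈ ponceletFamily S (ellipse f g a)) {i j k : Fin 3} (hj : i + 1 = j) (hk : i + 2 = k) :
    chordEquation (unitVertex T j) (unitVertex T k) (unitCoord S f) *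
        chordEquation (unitVertex T j) (unitVertex T k) (unitCoord S g) =
      (((2 * a) ^ 2 - dist f g ^ 2) / S.radius ^ 2 : ℝ) * (unitVertex T j * unitVertex T k) := by
  have hjk : j ≠ k := by rw [← hj, ← hk]; decide +revert
  obtain rfl := circumsphere_eq_of_mem_ponceletFamily hT
  have hR := circumsphere_radius_pos T
  have tangent := hT.2 i
  rw [sideline_eq, hj, hk] at tangent
  refine chordEquation_mul_chordEquation ((unitVertex_injective T).ne hjk) ?_
  rw [← tangent.im_mul_im_eq (T.independent.injective.ne hjk) ha, coe_unitVertex, coe_unitVertex,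
    unitCoord_sub_div_unitCoord_sub hR, unitCoord_sub_div_unitCoord_sub hR,
    norm_unitCoord_sub_unitCoord hR, dist_eq_norm]
  ring

theorem unitOrthocenter_eq_of_mem_ponceletFamily (ha : dist f g < 2 * a)
    (hT : T ∈ ponceletFamily S (ellipse f g a)) :
    unitOrthocenter T = unitCoord S f + unitCoord S g +
      (∏ i, unitVertex T i : Circle) * (conj (unitCoord S f) * conj (unitCoord S g)) := by
  rw [← unitVertex_add_unitVertex_add_unitVertex T 0, coe_prod_unitVertex T 0]
  exact sum_eq_of_chordEquation_mul ((unitVertex_injective T).ne (by decide))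
    ((unitVertex_injective T).ne (by decide)) ((unitVertex_injective T).ne (by decide))
    (chordEquation_unitVertex_mul ha hT (i := 2) rfl rfl)
    (chordEquation_unitVertex_mul ha hT (i := 0) rfl rfl)
    (chordEquation_unitVertex_mul ha hT (i := 1) rfl rfl)

theorem sq_sub_dist_sq_div_radius_sq_eq_of_mem_ponceletFamily (ha : dist f g < 2 * a)
    (hT : T ∈ ponceletFamily S (ellipse f g a)) :
    ((2 * a) ^ 2 - dist f g ^ 2) / S.radius ^ 2 =
      (1 - ‖unitCoord S f‖ ^ 2) * (1 - ‖unitCoord S g‖ ^ 2) := by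
  apply Complex.ofReal_injective
  rw [Complex.ofReal_mul, Complex.ofReal_sub, Complex.ofReal_sub, ofReal_norm_sq, ofReal_norm_sq]
  exact eq_one_sub_mul_of_chordEquation_mul ((unitVertex_injective T).ne (by decide))
    ((unitVertex_injective T).ne (by decide)) ((unitVertex_injective T).ne (by decide))
    (chordEquation_unitVertex_mul ha hT (i := 2) rfl rfl)
    (chordEquation_unitVertex_mul ha hT (i := 0) rfl rfl)
    (chordEquation_unitVertex_mul ha hT (i := 1) rfl rfl)

theorem unitOrthocenter_eq_sub_mul (ha : dist f g < 2 * a)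
    (hT₀ : T₀ ∈ ponceletFamily S (ellipse f g a)) (h₀ : unitOrthocenter T₀ = 0)
    (hT : T ∈ ponceletFamily S (ellipse f g a)) :
    unitOrthocenter T = ((∏ i, unitVertex T i : Circle) - (∏ i, unitVertex T₀ i : Circle)) *
      (conj (unitCoord S f) * conj (unitCoord S g)) := by
  have hp := unitOrthocenter_eq_of_mem_ponceletFamily ha hT
  have hp₀ := unitOrthocenter_eq_of_mem_ponceletFamily ha hT₀
  linear_combination hp - hp₀ + h₀

/- The orthocenter relation for the member with orthocenter `0` gives `‖F + G‖ = ‖F‖ * ‖G‖`, and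
then the parallelogram law gives `(2a / R)² = 1 + ‖F‖² + ‖G‖²`. -/
theorem two_mul_norm_mul_norm_lt_one (ha : dist f g < 2 * a)
    (hT₀ : T₀ ∈ ponceletFamily S (ellipse f g a)) (h₀ : unitOrthocenter T₀ = 0)
    (hO : dist S.center f + dist S.center g < 2 * a) :
    2 * (‖unitCoord S f‖ * ‖unitCoord S g‖) < 1 := by
  have hR : 0 < S.radius :=
    circumsphere_eq_of_mem_ponceletFamily hT₀ ▸ circumsphere_radius_pos T₀
  have axis_sq := sq_sub_dist_sq_div_radius_sq_eq_of_mem_ponceletFamily ha hT₀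
  rw [sub_div, ← div_pow, ← div_pow, ← norm_unitCoord_sub_unitCoord hR] at axis_sq
  have norm_add : ‖unitCoord S f + unitCoord S g‖ = ‖unitCoord S f‖ * ‖unitCoord S g‖ := by
    have hp₀ := unitOrthocenter_eq_of_mem_ponceletFamily ha hT₀
    rw [h₀, eq_comm, add_eq_zero_iff_eq_neg] at hp₀
    rw [hp₀, norm_neg, norm_mul, norm_mul, Circle.norm_coe, one_mul, Complex.norm_conj,
      Complex.norm_conj]
  have parallelogram := parallelogram_law_with_norm ℝ (unitCoord S f) (unitCoord S g)
  rw [norm_add] at parallelogram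
  have norm_add_norm_lt : ‖unitCoord S f‖ + ‖unitCoord S g‖ < 2 * a / S.radius := by
    rw [norm_unitCoord hR, norm_unitCoord hR, ← add_div, dist_comm f, dist_comm g]
    exact div_lt_div_of_pos_right hO hR
  have sq_lt := pow_lt_pow_left₀ norm_add_norm_lt (by positivity) two_ne_zero
  linarith

theorem acuteAngled_of_mem_ponceletFamily (ha : dist f g < 2 * a)
    (hT₀ : T₀ ∈ ponceletFamily S (ellipse f g a)) (h₀ : unitOrthocenter T₀ = 0)
    (hO : dist S.center f + dist S.center g < 2 * a)
    (hT : T ∈ ponceletFamily S (ellipse f g a)) : T.AcuteAngled := by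
  rw [acuteAngled_iff_norm_unitOrthocenter_lt_one, unitOrthocenter_eq_sub_mul ha hT₀ h₀ hT,
    norm_mul, norm_mul, Complex.norm_conj, Complex.norm_conj]
  refine lt_of_le_of_lt ?_ (two_mul_norm_mul_norm_lt_one ha hT₀ h₀ hO)
  gcongr
  refine (norm_sub_le _ _).trans_eq ?_
  rw [Circle.norm_coe, Circle.norm_coe]
  norm_num

theorem exists_circle_mul_eq_of_norm_eq {u v : ℂ} (h : ‖u‖ = ‖v‖) : ∃ k : Circle, k * u = v := by
  rcases eq_or_ne u 0 with rfl | hu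
  · rw [norm_zero, eq_comm, norm_eq_zero] at h
    exact ⟨1, by rw [h, mul_zero]⟩
  · refine ⟨⟨v / u, mem_sphere_zero_iff_norm.2 ?_⟩, div_mul_cancel₀ v hu⟩
    rw [norm_div, h, div_self (h ▸ norm_ne_zero_iff.2 hu)]

theorem exists_circle_mul_sub_mul_eq (q : Circle) (c : ℂ) :
    ∃ k : Circle, ∀ p : Circle, k * ((p - q) * c) = p * conj ((p - q) * c) := by
  obtain ⟨k, hk⟩ := exists_circle_mul_eq_of_norm_eq (u := q * c) (v := -conj c) (by
    rw [norm_mul, Circle.norm_coe, one_mul, norm_neg, Complex.norm_conj])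
  refine ⟨k, fun p ↦ ?_⟩
  rw [map_mul, map_sub, conj_coe_circle, conj_coe_circle]
  field_simp
  linear_combination (p - q) * hk

theorem exists_circle_mul_unitOrthocenter_eq (ha : dist f g < 2 * a)
    (hT₀ : T₀ ∈ ponceletFamily S (ellipse f g a)) (h₀ : unitOrthocenter T₀ = 0) :
    ∃ k : Circle, ∀ T ∈ ponceletFamily S (ellipse f g a),
      k * unitOrthocenter T = (∏ i, unitVertex T i : Circle) * conj (unitOrthocenter T) := by
  obtain ⟨k, hk⟩ := exists_circle_mul_sub_mul_eq (∏ i, unitVertex T₀ i)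
    (conj (unitCoord S f) * conj (unitCoord S g))
  exact ⟨k, fun T hT ↦ unitOrthocenter_eq_sub_mul ha hT₀ h₀ hT ▸ hk _⟩

end PonceletFamily

section Tangential

theorem sphere_isTangentAt_line_of_mem_orthRadius {V P : Type*} [NormedAddCommGroup V]
    [InnerProductSpace ℝ V] [MetricSpace P] [NormedAddTorsor V P] (hV : Module.finrank ℝ V = 2)
    {S : Sphere P} (hS : S.radius ≠ 0) {p q r : P} (hp : p ∈ S) (hqr : q ≠ r)
    (hq : q ∈ S.orthRadius p) (hr : r ∈ S.orthRadius p) : S.IsTangentAt p line[ℝ, q, r] := by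
  have : Fact (Module.finrank ℝ V = 1 + 1) := ⟨hV⟩
  have : FiniteDimensional ℝ V := .of_finrank_eq_succ hV
  have line_le : line[ℝ, q, r] ≤ S.orthRadius p := affineSpan_pair_le_of_mem_of_mem hq hr
  have p_ne : p ≠ S.center := by
    rintro rfl
    exact hS (by rw [← mem_sphere.1 hp, dist_self])
  have line_eq : line[ℝ, q, r] = S.orthRadius p := by
    refine AffineSubspace.eq_of_direction_eq_of_nonempty_of_le
      (Submodule.eq_of_le_of_finrank_eq (AffineSubspace.direction_le line_le) ?_)
      ⟨q, left_mem_affineSpan_pair _ _ _⟩ line_le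
    have := Sphere.finrank_orthRadius p_ne
    rw [direction_affineSpan, vectorSpan_pair, finrank_span_singleton (vsub_ne_zero.2 hqr)]
    omega
  rw [line_eq]
  exact Sphere.isTangentAt_orthRadius_iff_mem.2 hp

theorem insphere_eq_of_isTangent {S : Sphere ℂ} {T : Affine.Triangle ℝ ℂ}
    (ht : ∀ i, S.IsTangent (sideline T i)) {w : Fin 3 → ℝ} (hw : ∑ i, w i = 1)
    (hpos : ∀ i, 0 < w i) (hc : ∑ i, w i • T.points i = S.center) : T.insphere = S := by
  have center_mem : S.center ∈ affineSpan ℝ (Set.range T.points) := by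
    rw [affineSpan_range_points_eq_top]
    exact AffineSubspace.mem_top _ _ _
  have signedInfDist_eq (i : Fin 3) : T.signedInfDist i S.center = S.radius := by
    have nonneg : 0 ≤ T.signedInfDist i S.center := by
      rw [← hc, ← Finset.affineCombination_eq_linear_combination _ _ _ hw,
        T.signedInfDist_affineCombination i hw]
      exact mul_nonneg (hpos i).le (norm_nonneg _)
    rw [← abs_of_nonneg nonneg, T.abs_signedInfDist_eq_dist_of_mem_affineSpan_range i center_mem]
    exact Sphere.dist_orthogonalProjection_eq_radius_iff_isTangent.2 (ht i)
  have center_eq := (T.exists_forall_signedInfDist_eq_iff_eq_incenter center_mem).1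
    ⟨_, signedInfDist_eq⟩
  refine Sphere.ext center_eq.symm ?_
  rw [Affine.Simplex.insphere_radius, ← T.signedInfDist_incenter 0, ← center_eq,
    signedInfDist_eq]

section InnerSum

variable {ι V : Type*} [NormedAddCommGroup V] [InnerProductSpace ℝ V]

theorem inner_sum_smul_of_inner_eq [Fintype ι] {j : ι} {u : V} {v : ι → V} {c : ℝ}
    (h : ∀ i ≠ j, inner ℝ u (v i) = c) (w : ι → ℝ) :
    inner ℝ u (∑ i, w i • v i) = (∑ i, w i) * c - w j * (c - inner ℝ u (v j)) := by
  classical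
  have hsingle : ∑ i, w i * (c - inner ℝ u (v i)) = w j * (c - inner ℝ u (v j)) :=
    Finset.sum_eq_single j (fun i _ hij ↦ by rw [h i hij, sub_self, mul_zero]) (by simp)
  rw [← hsingle, Finset.sum_mul, ← Finset.sum_sub_distrib, inner_sum]
  exact Finset.sum_congr rfl fun i _ ↦ by rw [real_inner_smul_right]; ring

theorem affineIndependent_of_inner_eq [Finite ι] {u v : ι → V} {c : ι → ℝ}
    (hne : ∀ j, ∀ i ≠ j, inner ℝ (u j) (v i) = c j) (hself : ∀ j, inner ℝ (u j) (v j) ≠ c j) :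
    AffineIndependent ℝ v := by
  have := Fintype.ofFinite ι
  rw [affineIndependent_iff_of_fintype]
  intro w hw hsum j
  rw [Finset.weightedVSub_eq_linear_combination _ hw] at hsum
  have hj := inner_sum_smul_of_inner_eq (hne j) w
  rw [hsum, inner_zero_right, hw, zero_mul, zero_sub, eq_comm, neg_eq_zero] at hj
  exact (mul_eq_zero.1 hj).resolve_right (sub_ne_zero.2 (hself j).symm)

end InnerSum

theorem inner_add_ofReal_mul (u p v : ℂ) (r : ℝ) :
    inner ℝ u (p + r * v) = inner ℝ u p + r * inner ℝ u v := by
  rw [inner_add_right, ← Complex.real_smul, real_inner_smul_right]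

theorem mem_orthRadius_points_iff (T : Affine.Triangle ℝ ℂ) (i : Fin 3) (q : ℂ) :
    q ∈ T.circumsphere.orthRadius (T.points i) ↔
      inner ℝ (unitVertex T i : ℂ) (unitCoord T.circumsphere q) = 1 := by
  have hR := circumsphere_radius_pos T
  have unitCoord_center : unitCoord T.circumsphere T.circumsphere.center = 0 := by
    rw [unitCoord, sub_self, zero_div]
  rw [Sphere.mem_orthRadius_iff_inner_right, vsub_eq_sub, vsub_eq_sub, inner_sub_sub_eq hR,
    unitCoord_center, sub_zero, ← coe_unitVertex, inner_sub_right, real_inner_self_eq_norm_sq,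
    Circle.norm_coe, one_pow, mul_eq_zero_iff_left (pow_pos hR 2).ne', sub_eq_zero]

theorem eq_add_one_or_eq_add_two_of_ne {i j : Fin 3} (h : i ≠ j) : j = i + 1 ∨ j = i + 2 := by
  decide +revert

/-- The vertices of the tangential triangle of `T` in the coordinate in which the circumcircle of
`T` is the unit circle. -/
noncomputable def tangentialVertex (T : Affine.Triangle ℝ ℂ) (i : Fin 3) : ℂ :=
  chordPole (unitVertex T (i + 1)) (unitVertex T (i + 2))

variable {T T' : Affine.Triangle ℝ ℂ}

theorem unitVertex_add_ne_zero (hT : T.AcuteAngled) (i : Fin 3) :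
    (unitVertex T (i + 1) + unitVertex T (i + 2) : ℂ) ≠ 0 := by
  rw [acuteAngled_iff_norm_unitOrthocenter_lt_one,
    ← unitVertex_add_unitVertex_add_unitVertex T i] at hT
  exact add_ne_zero_of_norm_sum_lt_one hT

theorem inner_tangentialVertex_of_ne (hT : T.AcuteAngled) {i j : Fin 3} (hij : i ≠ j) :
    inner ℝ (unitVertex T i : ℂ) (tangentialVertex T j) = 1 := by
  rcases eq_add_one_or_eq_add_two_of_ne hij.symm with rfl | rfl
  · exact inner_chordPole_left (unitVertex_add_ne_zero hT j)
  · exact inner_chordPole_right (unitVertex_add_ne_zero hT j)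

theorem inner_tangentialVertex_self_lt_one (hT : T.AcuteAngled) (i : Fin 3) :
    inner ℝ (unitVertex T i : ℂ) (tangentialVertex T i) < 1 := by
  rw [acuteAngled_iff_norm_unitOrthocenter_lt_one,
    ← unitVertex_add_unitVertex_add_unitVertex T i] at hT
  refine inner_chordPole_lt_one ?_ ?_ ?_ hT <;> refine (unitVertex_injective T).ne ?_ <;>
    clear hT <;> decide +revert

theorem affineIndependent_center_add_mul_tangentialVertex (hT : T.AcuteAngled) :
    AffineIndependent ℝ
      fun i ↦ T.circumsphere.center + T.circumsphere.radius * tangentialVertex T i := by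
  have hR := circumsphere_radius_pos T
  refine affineIndependent_of_inner_eq (u := fun j ↦ (unitVertex T j : ℂ))
    (c := fun j ↦ inner ℝ (unitVertex T j : ℂ) T.circumsphere.center + T.circumsphere.radius * 1)
    (fun j i hij ↦ ?_) fun j ↦ ?_
  · rw [inner_add_ofReal_mul, inner_tangentialVertex_of_ne hT hij.symm]
  · rw [inner_add_ofReal_mul, Ne, add_right_inj, mul_right_inj' hR.ne']
    exact (inner_tangentialVertex_self_lt_one hT j).ne

theorem exists_isTangentialTriangle (hT : T.AcuteAngled) : ∃ T', IsTangentialTriangle T T' := by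
  have hR := circumsphere_radius_pos T
  have independent := affineIndependent_center_add_mul_tangentialVertex hT
  refine ⟨⟨_, independent⟩, fun i ↦ ?_⟩
  have mem_tangent {j : Fin 3} (hij : i ≠ j) :
      T.circumsphere.center + T.circumsphere.radius * tangentialVertex T j ∈
        T.circumsphere.orthRadius (T.points i) := by
    rw [mem_orthRadius_points_iff, unitCoord_center_add hR, inner_tangentialVertex_of_ne hT hij]
  rw [sideline_eq]
  exact sphere_isTangentAt_line_of_mem_orthRadius Complex.finrank_real_complex hR.ne'
    (T.mem_circumsphere i) (independent.injective.ne (by simp)) (mem_tangent (by simp))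
    (mem_tangent (by simp))

theorem IsTangentialTriangle.unitCoord_points_eq (h : IsTangentialTriangle T T')
    (hT : T.AcuteAngled) (i : Fin 3) :
    unitCoord T.circumsphere (T'.points i) = tangentialVertex T i := by
  have inner_eq {j : Fin 3} (hji : j ≠ i) :
      inner ℝ (unitVertex T j : ℂ) (unitCoord T.circumsphere (T'.points i)) = 1 := by
    rw [← mem_orthRadius_points_iff]
    refine (h j).le_orthRadius ?_
    rw [sideline_eq]
    rcases eq_add_one_or_eq_add_two_of_ne hji with rfl | rfl
    · exact left_mem_affineSpan_pair _ _ _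
    · exact right_mem_affineSpan_pair _ _ _
  exact eq_chordPole ((unitVertex_injective T).ne (by clear inner_eq; decide +revert))
    (unitVertex_add_ne_zero hT i) (inner_eq (by simp)) (inner_eq (by simp))

theorem IsTangentialTriangle.points_eq (h : IsTangentialTriangle T T') (hT : T.AcuteAngled)
    (i : Fin 3) : T'.points i =
      T.circumsphere.center + T.circumsphere.radius * tangentialVertex T i := by
  rw [← h.unitCoord_points_eq hT, center_add_mul_unitCoord (circumsphere_radius_pos T)]

theorem IsTangentialTriangle.insphere_eq (h : IsTangentialTriangle T T') (hT : T.AcuteAngled) :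
    T'.insphere = T.circumsphere := by
  have hR := circumsphere_radius_pos T
  have center_mem : T.circumsphere.center ∈ affineSpan ℝ (Set.range T'.points) := by
    rw [affineSpan_range_points_eq_top]
    exact AffineSubspace.mem_top _ _ _
  obtain ⟨w, hw, hc⟩ := eq_affineCombination_of_mem_affineSpan_of_fintype center_mem
  rw [Finset.affineCombination_eq_linear_combination _ _ _ hw] at hc
  refine insphere_eq_of_isTangent (fun i ↦ (h i).isTangent) hw (fun j ↦ ?_) hc.symm
  have inner_points_eq (i : Fin 3) (hij : i ≠ j) :
      inner ℝ (unitVertex T j : ℂ) (T'.points i) =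
        inner ℝ (unitVertex T j : ℂ) T.circumsphere.center + T.circumsphere.radius := by
    rw [h.points_eq hT, inner_add_ofReal_mul, inner_tangentialVertex_of_ne hT hij.symm, mul_one]
  have weight_eq : w j * (1 - inner ℝ (unitVertex T j : ℂ) (tangentialVertex T j)) = 1 := by
    have hj := inner_sum_smul_of_inner_eq inner_points_eq w
    rw [← hc, hw, h.points_eq hT, inner_add_ofReal_mul] at hj
    refine mul_left_cancel₀ hR.ne' ?_
    linear_combination hj
  exact pos_of_mul_pos_left (one_pos.trans_eq weight_eq.symm)
    (sub_pos.2 (inner_tangentialVertex_self_lt_one hT j)).le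

end Tangential

section NinePoint

theorem ninePointCircle_center_eq (T : Affine.Triangle ℝ ℂ) :
    T.ninePointCircle.center = (∑ i, T.points i - T.circumcenter) / 2 := by
  have hw := Finset.sum_centroidWeights_eq_one_of_card_ne_zero ℝ (Finset.univ : Finset (Fin 3))
    (by simp)
  rw [Affine.Simplex.ninePointCircle_center, Affine.Simplex.centroid, Finset.centroid_def,
    Finset.affineCombination_eq_linear_combination _ _ _ hw]
  simp only [Finset.centroidWeights_apply, Finset.card_univ, Fintype.card_fin, vsub_eq_sub,
    vadd_eq_add, Complex.real_smul, ← Finset.mul_sum]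
  push_cast
  ring

theorem sphere_isIntTangentAt_homothety {V P : Type*} [NormedAddCommGroup V]
    [InnerProductSpace ℝ V] [MetricSpace P] [NormedAddTorsor V P] {S : Sphere P} {p : P}
    (hp : p ∈ S) {r : ℝ} (hr : 1 ≤ r) :
    S.IsIntTangentAt ⟨AffineMap.homothety p r S.center, r * S.radius⟩ p where
  mem_left := hp
  mem_right := by
    have hr0 : 0 ≤ r := zero_le_one.trans hr
    rw [mem_sphere, dist_comm, dist_homothety_center, Real.norm_of_nonneg hr0,
      mem_sphere.1 hp]
  wbtw := by
    have hr0 : 0 < r := zero_lt_one.trans_le hr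
    refine ((wbtw_comm ..).1 ⟨r⁻¹, ⟨(inv_pos.2 hr0).le, inv_le_one_of_one_le₀ hr⟩, ?_⟩)
    rw [AffineMap.homothety_eq_lineMap, AffineMap.lineMap_lineMap_right, inv_mul_cancel₀ hr0.ne',
      AffineMap.lineMap_apply_one]

variable {T T' : Affine.Triangle ℝ ℂ}

theorem IsTangentialTriangle.dist_points_eq (h : IsTangentialTriangle T T') (hT : T.AcuteAngled)
    (i : Fin 3) : dist (T'.points i) (T.circumsphere.center - T.circumsphere.radius *
      ((2 / (1 - ‖unitOrthocenter T‖ ^ 2) : ℝ) * unitOrthocenter T)) =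
        T.circumsphere.radius * (2 / (1 - ‖unitOrthocenter T‖ ^ 2)) := by
  have hlt := (acuteAngled_iff_norm_unitOrthocenter_lt_one T).1 hT
  have hpos : 0 < 1 - ‖unitOrthocenter T‖ ^ 2 :=
    sub_pos.2 ((sq_lt_one_iff₀ (norm_nonneg _)).2 hlt)
  have tangentialVertex_add := chordPole_add_eq
    ((unitVertex_add_unitVertex_add_unitVertex T i).symm ▸ hlt)
  rw [unitVertex_add_unitVertex_add_unitVertex, ← tangentialVertex] at tangentialVertex_add
  rw [dist_eq_norm, h.points_eq hT, add_sub_sub_cancel, ← mul_add, tangentialVertex_add, norm_mul,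
    norm_mul, norm_neg, Circle.norm_coe, mul_one, Complex.norm_real, Complex.norm_real,
    Real.norm_of_nonneg (circumsphere_radius_pos T).le, Real.norm_of_nonneg (by positivity)]

theorem sum_tangentialVertex_add (hT : T.AcuteAngled) {k : ℂ}
    (hk : k * unitOrthocenter T = (∏ i, unitVertex T i : Circle) * conj (unitOrthocenter T)) :
    ∑ i, tangentialVertex T i + (2 / (1 - ‖unitOrthocenter T‖ ^ 2) : ℝ) * unitOrthocenter T =
      -(2 / (1 - ‖unitOrthocenter T‖ ^ 2) : ℝ) * ((‖unitOrthocenter T‖ ^ 2 : ℝ) * k) := by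
  have hsum := unitVertex_add_unitVertex_add_unitVertex T 0
  have hlt := (acuteAngled_iff_norm_unitOrthocenter_lt_one T).1 hT
  have hpole := chordPole_add_chordPole_add_chordPole (hsum.symm ▸ hlt)
  rw [hsum, ← coe_prod_unitVertex] at hpole
  rw [ofReal_norm_sq]
  refine (Eq.trans ?_ hpole).trans ?_
  · rw [Fin.sum_univ_three]
    rfl
  · linear_combination
      (2 / (1 - ‖unitOrthocenter T‖ ^ 2) : ℝ) * conj (unitOrthocenter T) * hk

theorem IsTangentialTriangle.ninePointCircle_eq (h : IsTangentialTriangle T T')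
    (hT : T.AcuteAngled) {k : ℂ}
    (hk : k * unitOrthocenter T = (∏ i, unitVertex T i : Circle) * conj (unitOrthocenter T)) :
    T'.ninePointCircle =
      ⟨AffineMap.homothety (T.circumsphere.center + T.circumsphere.radius * k)
        (1 - ‖unitOrthocenter T‖ ^ 2)⁻¹ T.circumsphere.center,
        (1 - ‖unitOrthocenter T‖ ^ 2)⁻¹ * T.circumsphere.radius⟩ := by
  have hlt := (acuteAngled_iff_norm_unitOrthocenter_lt_one T).1 hT
  have hne : ((1 - ‖unitOrthocenter T‖ ^ 2 : ℝ) : ℂ) ≠ 0 := by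
    exact_mod_cast (sub_pos.2 ((sq_lt_one_iff₀ (norm_nonneg _)).2 hlt)).ne'
  have mem_span (p : ℂ) : p ∈ affineSpan ℝ (Set.range T'.points) := by
    rw [affineSpan_range_points_eq_top]
    exact AffineSubspace.mem_top _ _ _
  have circumcenter_eq := T'.eq_circumcenter_of_dist_eq (mem_span _) (h.dist_points_eq hT)
  have circumradius_eq := T'.eq_circumradius_of_dist_eq (mem_span _) (h.dist_points_eq hT)
  have hsum := sum_tangentialVertex_add hT hk
  refine Sphere.ext ?_ ?_
  · rw [ninePointCircle_center_eq, ← circumcenter_eq, Finset.sum_congr rfl fun i _ ↦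
      h.points_eq hT i, Finset.sum_add_distrib, ← Finset.mul_sum, Finset.sum_const,
      Finset.card_univ, Fintype.card_fin, AffineMap.homothety_apply, vsub_eq_sub, vadd_eq_add,
      Complex.real_smul]
    rw [Complex.ofReal_div] at hsum ⊢
    push_cast at hne hsum ⊢
    field_simp at hsum ⊢
    linear_combination T.circumsphere.radius * hsum
  · rw [Affine.Simplex.ninePointCircle_radius, ← circumradius_eq]
    push_cast
    ring

theorem IsTangentialTriangle.isFeuerbachPoint (h : IsTangentialTriangle T T')
    (hT : T.AcuteAngled) (h0 : unitOrthocenter T ≠ 0) {k : Circle}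
    (hk : k * unitOrthocenter T = (∏ i, unitVertex T i : Circle) * conj (unitOrthocenter T)) :
    IsFeuerbachPoint T' (T.circumsphere.center + T.circumsphere.radius * k) := by
  have hR := circumsphere_radius_pos T
  have hlt := (acuteAngled_iff_norm_unitOrthocenter_lt_one T).1 hT
  have one_lt : 1 < (1 - ‖unitOrthocenter T‖ ^ 2)⁻¹ :=
    one_lt_inv₀ (sub_pos.2 ((sq_lt_one_iff₀ (norm_nonneg _)).2 hlt)) |>.2
      (sub_lt_self _ (pow_pos (norm_pos_iff.2 h0) 2))
  rw [IsFeuerbachPoint, h.insphere_eq hT, h.ninePointCircle_eq hT hk]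
  refine ⟨fun heq ↦ ?_, sphere_isIntTangentAt_homothety ?_ one_lt.le⟩
  · exact (lt_mul_of_one_lt_left hR one_lt).ne (congrArg Sphere.radius heq)
  · exact center_add_mul_circle_mem hR.le k

theorem IsTangentialTriangle.equilateral (h : IsTangentialTriangle T T') (hT : T.AcuteAngled)
    (h0 : unitOrthocenter T = 0) : T'.Equilateral := by
  have hR := circumsphere_radius_pos T
  have sum_eq (i : Fin 3) := (unitVertex_add_unitVertex_add_unitVertex T i).trans h0
  have points_eq (i : Fin 3) : T'.points i =
      T.circumsphere.center + T.circumsphere.radius * (-2 * unitVertex T i) := by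
    rw [h.points_eq hT, tangentialVertex, chordPole_eq_of_sum_eq_zero (sum_eq i)]
  have dist_eq (i : Fin 3) :
      dist (T'.points i) (T'.points (i + 1)) = T.circumsphere.radius * (2 * √3) := by
    rw [points_eq, points_eq, dist_add_left, dist_eq_norm, ← mul_sub, ← mul_sub, norm_mul, norm_mul,
      Complex.norm_real, Real.norm_of_nonneg hR.le, ← norm_sub_sq_of_sum_eq_zero (sum_eq i),
      Real.sqrt_sq (norm_nonneg _), norm_neg, Complex.norm_ofNat]
  refine ⟨T.circumsphere.radius * (2 * √3), fun i j hij ↦ ?_⟩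
  rcases eq_add_one_or_eq_add_two_of_ne hij with rfl | rfl
  · exact dist_eq i
  · rw [dist_comm, ← dist_eq (i + 2)]
    congr 2
    clear hij
    decide +revert

end NinePoint

theorem mainTheorem6_general (S : Sphere ℂ) (f g : ℂ) (a : ℝ) (ha : dist f g < 2 * a)
    (hequi : ∃ T ∈ ponceletFamily S (ellipse f g a), T.Equilateral) :
    (∃ T ∈ ponceletFamily S (ellipse f g a),
      ∃ T', IsTangentialTriangle T T' ∧ T'.Equilateral) ∧
    (dist S.center f + dist S.center g < 2 * a →
      ∀ T ∈ ponceletFamily S (ellipse f g a), T.AcuteAngled) ∧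
    ∃ K ∈ S, ∀ T ∈ ponceletFamily S (ellipse f g a), T.AcuteAngled →
      (∃ T', IsTangentialTriangle T T') ∧
      ∀ T', IsTangentialTriangle T T' →
        T'.insphere = S ∧
        (¬ T'.Equilateral → IsFeuerbachPoint T' K ∧ x110 T = K) := by
  obtain ⟨T₀, hT₀, he⟩ := hequi
  have h₀ := unitOrthocenter_eq_zero_of_equilateral he
  obtain ⟨k, hk⟩ := exists_circle_mul_unitOrthocenter_eq ha hT₀ h₀
  refine ⟨?_, fun hO T hT ↦ acuteAngled_of_mem_ponceletFamily ha hT₀ h₀ hO hT,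
    S.center + S.radius * k, ?_, fun T hT hacute ↦
      ⟨exists_isTangentialTriangle hacute, fun T' hT' ↦ ?_⟩⟩
  · obtain ⟨T', hT'⟩ := exists_isTangentialTriangle he.acuteAngled
    exact ⟨T₀, hT₀, T', hT', hT'.equilateral he.acuteAngled h₀⟩
  · rw [← circumsphere_eq_of_mem_ponceletFamily hT₀]
    exact center_add_mul_circle_mem (circumsphere_radius_pos T₀).le k
  · have circumsphere_eq := circumsphere_eq_of_mem_ponceletFamily hT
    refine ⟨(hT'.insphere_eq hacute).trans circumsphere_eq, fun hne ↦ ?_⟩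
    have orthocenter_ne : unitOrthocenter T ≠ 0 := fun h ↦ hne (hT'.equilateral hacute h)
    rw [← circumsphere_eq]
    exact ⟨hT'.isFeuerbachPoint hacute orthocenter_ne (hk T hT),
      x110_eq_of_mul_unitOrthocenter_eq orthocenter_ne (hk T hT)⟩

theorem mainTheorem6 (S : Sphere ℂ) (hS : 0 < S.radius)
    (f g : ℂ) (a : ℝ) (ha : dist f g < 2 * a)
    (hnested : ∀ z ∈ ellipse f g a, dist z S.center < S.radius)
    (hequi : ∃ T ∈ ponceletFamily S (ellipse f g a), T.Equilateral) :
    -- the tangential family contains an equilateral triangle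
    (∃ T ∈ ponceletFamily S (ellipse f g a),
      ∃ T', IsTangentialTriangle T T' ∧ T'.Equilateral) ∧
    -- if the center of the circle is inside the caustic, all members of the family are acute
    (dist S.center f + dist S.center g < 2 * a →
      ∀ T ∈ ponceletFamily S (ellipse f g a), T.AcuteAngled) ∧
    -- acute members have a tangential triangle, all of these circumscribe the circle `S`,
    -- and all of them, except equilateral ones, have the same Feuerbach point
    ∃ K ∈ S, ∀ T ∈ ponceletFamily S (ellipse f g a), T.AcuteAngled →
      (∃ T', IsTangentialTriangle T T') ∧
      ∀ T', IsTangentialTriangle T T' →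
        T'.insphere = S ∧
        (¬ T'.Equilateral → IsFeuerbachPoint T' K ∧ x110 T = K) :=
  mainTheorem6_general S f g a ha hequi
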